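/- Let $k\ge 1$ be an integer. For $\alpha\in\mathbb R$ let $F_\alpha$ be the (complex, algebraic) Fock module of charge $\alpha$: it has a highest weight vector $|\alpha\rangle$ and operators $a_n$ ($n\in\mathbb Z$) with $[a_n,a_m]=n\,\delta_{n+m,0}$, $a_0=\alpha$, $a_n|\alpha\rangle=0$ for $n>0$, and it has as a basis the monomials in $a_{-1},a_{-2},\dots$ applied to $|\alpha\rangle$. Consider the set of charges $\Lambda=\{\alpha_{nm}: n,m\in\mathbb Z\}$, $\alpha_{nm}=n\sqrt{2k}+\frac{m}{\sqrt{2k}}$, and the chiral space $$H=\bigoplus_{\alpha\in\Lambda}F_\alpha$$ (algebraic direct sum, each charge of the set $\Lambda$ being taken once). On $H$ consider the modes $J^0_n=\frac{1}{\sqrt{2k}}\,a_n$ of the $U(1)$ current $J^0(z)=\frac{1}{\sqrt{2k}}\,i\partial\phi(z)=\sum_n J^0_n z^{-n-1}$, and the modes $J^\pm_n$ of the spin-$k$ currents $$J^{\pm}(z)=\,:\!e^{\pm i\sqrt{2k}\,\phi(z)}\!:\;=\sum_{n\in\mathbb Z}J^\pm_n z^{-n-k},\qquad :\!e^{i\beta\phi(z)}\!:\;=e^{\beta\sum_{n>0}\frac{a_{-n}}{n}z^n}\,e^{-\beta\sum_{n>0}\frac{a_n}{n}z^{-n}}\,T_\beta\,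 z^{\beta a_0},$$ where $T_\beta:F_\alpha\to F_{\alpha+\beta}$ is the linear isomorphism that sends $|\alpha\rangle$ to $|\alpha+\beta\rangle$ and commutes with all $a_n$, $n\neq0$. Let $\mathcal A$ be the algebra of operators on $H$ generated by all $J^+_n$, $J^-_n$, $J^0_n$, $n\in\mathbb Z$. Then $$H=\bigoplus_{m=0}^{2k-1}\mathcal H_m,\qquad \mathcal H_m=\bigoplus_{n\in\mathbb Z}F_{\frac{m}{\sqrt{2k}}+n\sqrt{2k}},$$ and each $\mathcal H_m$ is an $\mathcal A$-submodule of $H$ that is irreducible as an $\mathcal A$-module. -/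

import Mathlib

noncomputable section

namespace TorusModel

/-- The (algebraic) Fock module `F_α` of charge `α`. The polynomial `1` is the highest weight
vector `|α⟩`, and the monomial `∏ X_j ^ e_j` is the state `∏ (a_{-(j+1)}) ^ e_j |α⟩`. -/
abbrev Fock (_α : ℝ) : Type := MvPolynomial ℕ ℂ

/-- The oscillator modes `a_n`, `n ∈ ℤ`, on `F_α`, with `[a_n, a_m] = n δ_{n+m,0}`:
`a_0` is the charge, `a_{j+1} = (j+1) ∂/∂X_j`, and `a_{-(j+1)}` is multiplication by `X_j`. -/
def oscillator (α : ℝ) : ℤ → Module.End ℂ (Fock α)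
  | Int.ofNat 0 => (α : ℂ) • LinearMap.id
  | Int.ofNat (j + 1) => ((j + 1 : ℕ) : ℂ) • (MvPolynomial.pderiv j).toLinearMap
  | Int.negSucc j => LinearMap.mulLeft ℂ (MvPolynomial.X j)

/-- The coefficient of `w ^ N` in `exp (∑_{i > 0} t_i w ^ i) = ∑_l (∑_{i > 0} t_i w ^ i) ^ l / l!`:
the `l`-th power contributes the products `t_{i_1} ⋯ t_{i_l}` with `i_1 + ⋯ + i_l = N`. -/
def expCoeff {A : Type*} [Ring A] [Algebra ℂ A] (t : ℕ → A) (N : ℕ) : A :=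
  ∑ c : Composition N, ((c.length.factorial : ℂ)⁻¹) • (c.blocks.map t).prod

/-- The coefficient of `z ^ N` in `exp (β ∑_{n > 0} (a_{-n} / n) z ^ n)`. -/
def creationCoeff (α β : ℝ) (N : ℕ) : Module.End ℂ (Fock α) :=
  expCoeff (fun n : ℕ => ((β : ℂ) / (n : ℂ)) • oscillator α (-(n : ℤ))) N

/-- The coefficient of `z ^ (-N)` in `exp (-β ∑_{n > 0} (a_n / n) z ^ (-n))`. -/
def annihilationCoeff (α β : ℝ) (N : ℕ) : Module.End ℂ (Fock α) :=
  expCoeff (fun n : ℕ => (-(β : ℂ) / (n : ℂ)) • oscillator α (n : ℤ)) N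

/-- The level of the state `∏ (a_{-(j+1)}) ^ e_j |α⟩`. -/
def level (e : ℕ →₀ ℕ) : ℕ := Finsupp.weight (fun j : ℕ => j + 1) e

theorem list_prod_annihilation_eq_zero (α : ℝ) (c : ℕ → ℂ) (l : List ℕ) :
    (∀ i ∈ l, 0 < i) → ∀ (e : ℕ →₀ ℕ) (x : ℂ), level e < l.sum →
      (l.map fun n : ℕ => c n • oscillator α (n : ℤ)).prod (MvPolynomial.monomial e x) = 0 := by
  induction l using List.reverseRecOn with
  | nil => intro _ e x h; simp at h
  | append_singleton l n ih =>
    intro hpos e x h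
    have hn : 0 < n := hpos n (by simp)
    obtain ⟨j, rfl⟩ : ∃ j, n = j + 1 := ⟨n - 1, by omega⟩
    rw [List.map_append, List.prod_append]
    have hosc : oscillator α ((j + 1 : ℕ) : ℤ) =
      ((j + 1 : ℕ) : ℂ) • (MvPolynomial.pderiv (R := ℂ) j).toLinearMap := rfl
    simp only [List.map_cons, List.map_nil, List.prod_cons, List.prod_nil, mul_one,
      Module.End.mul_apply, LinearMap.smul_apply, hosc, Derivation.coeFn_coe,
      MvPolynomial.pderiv_monomial, map_smul]
    by_cases hj : e j = 0
    · simp [hj]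
    · have hlev : level (e - Finsupp.single j 1) + (j + 1) = level e := by
        have h1 : e = (e - Finsupp.single j 1) + Finsupp.single j 1 := by
          ext i
          by_cases hi : i = j
          · subst hi; simp; omega
          · simp [Ne.symm hi]
        conv_rhs => rw [h1]
        simp [level, Finsupp.weight_single]
      rw [ih (fun i hi => hpos i (by simp [hi]))]
      · simp
      · simp at h; omega

/-- On each vector only finitely many annihilation coefficients are nonzero. -/
theorem annihilationCoeff_locally_finite (α β : ℝ) (v : Fock α) :
    {N : ℕ | annihilationCoeff α β N v ≠ 0}.Finite := by
  suffices h : ∃ B : ℕ, ∀ N, B ≤ N → annihilationCoeff α β N v = 0 by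
    obtain ⟨B, hB⟩ := h
    refine (Set.finite_lt_nat B).subset fun N hN => ?_
    by_contra hc
    exact hN (hB N (not_lt.mp hc))
  induction v using MvPolynomial.induction_on' with
  | monomial e x =>
    refine ⟨level e + 1, fun N hN => ?_⟩
    simp only [annihilationCoeff, expCoeff, LinearMap.sum_apply, LinearMap.smul_apply]
    refine Finset.sum_eq_zero fun c _ => ?_
    rw [list_prod_annihilation_eq_zero α (fun n : ℕ => -(β : ℂ) / (n : ℂ)) c.blocks
      (fun i hi => c.blocks_pos hi) e x (by rw [c.blocks_sum]; omega), smul_zero]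
  | add p q hp hq =>
    obtain ⟨B, hB⟩ := hp
    obtain ⟨C, hC⟩ := hq
    refine ⟨max B C, fun N hN => ?_⟩
    rw [map_add, hB N (le_trans (le_max_left _ _) hN), hC N (le_trans (le_max_right _ _) hN),
      add_zero]

/-- The pairs `(M, N)` for which `z ^ M * z ^ (-N) * z ^ (β α) = z ^ x`. -/
def exponentPairs (α β x : ℝ) : Set (ℕ × ℕ) := {p | (p.1 : ℝ) - (p.2 : ℝ) + β * α = x}

theorem vertexCoeff_finite (α β x : ℝ) (v : Fock α) :
    (exponentPairs α β x ∩ Function.support (fun p : ℕ × ℕ =>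
      creationCoeff (α + β) β p.1 (annihilationCoeff α β p.2 v))).Finite := by
  refine Set.Finite.of_finite_image (f := Prod.snd) ?_ ?_
  · refine (annihilationCoeff_locally_finite α β v).subset ?_
    rintro _ ⟨p, ⟨-, hp⟩, rfl⟩ h0
    exact hp (by simp [h0])
  · rintro ⟨a, b⟩ ⟨hp, -⟩ ⟨c, d⟩ ⟨hq, -⟩ (rfl : b = d)
    simp only [exponentPairs, Set.mem_ofPred_eq] at hp hq
    have : (a : ℝ) = c := by linarith
    rw [Nat.cast_injective this]

/-- The coefficient of `z ^ x` in the normally ordered vertex operator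
`:e^{iβφ(z)}: = exp (β ∑_{n>0} (a_{-n}/n) z^n) exp (-β ∑_{n>0} (a_n/n) z^{-n}) e^{iβx̂} z^{β a_0}`
acting from `F_α` to `F_{α+β}`. The factor `e^{iβx̂}` maps a state of `F_α` to the state of
`F_{α+β}` given by the same polynomial. -/
def vertexCoeff (α β x : ℝ) : Fock α →ₗ[ℂ] Fock (α + β) where
  toFun v := ∑ᶠ p ∈ exponentPairs α β x,
    creationCoeff (α + β) β p.1 (annihilationCoeff α β p.2 v)
  map_add' v w := by
    simp only [map_add]
    exact finsum_mem_add_distrib' (vertexCoeff_finite α β x v) (vertexCoeff_finite α β x w)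
  map_smul' r v := by
    simp only [map_smul, RingHom.id_apply]
    exact ((DistribSMul.toAddMonoidHom (Fock (α + β)) r).map_finsum_mem'
      (vertexCoeff_finite α β x v)).symm

/-- The set of charges `α_{nm} = n √(2k) + m / √(2k)`, `n, m ∈ ℤ`. -/
def charges (k : ℕ) : Set ℝ :=
  {α | ∃ n m : ℤ, α = n * √(2 * k) + m / √(2 * k)}

/-- The chiral space `H`: the direct sum of one Fock module for each charge in the set. -/
def ChiralSpace (k : ℕ) : Type := DirectSum (charges k) (fun α => Fock α)

instance (k : ℕ) : AddCommGroup (ChiralSpace k) :=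
  inferInstanceAs (AddCommGroup (DirectSum (charges k) (fun α => Fock α)))

instance (k : ℕ) : Module ℂ (ChiralSpace k) :=
  inferInstanceAs (Module ℂ (DirectSum (charges k) (fun α => Fock α)))

/-- The inclusion of the summand `F_α` in `H`. -/
def fockInclusion (k : ℕ) (α : charges k) : Fock α →ₗ[ℂ] ChiralSpace k :=
  DirectSum.lof ℂ (charges k) (fun α => Fock α) α

/-- The operator on `H` that is given by `f α` on each summand `F_α`. -/
def assemble (k : ℕ) (f : ∀ α : charges k, Fock α →ₗ[ℂ] ChiralSpace k) :
    Module.End ℂ (ChiralSpace k) :=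
  DirectSum.toModule ℂ (charges k) (ChiralSpace k) f

/-- The charge `α + ε √(2k)`. -/
def shiftCharge (k : ℕ) (ε : ℤ) (α : charges k) : charges k :=
  ⟨α + ε * √(2 * k), by
    obtain ⟨_, n, m, rfl⟩ := α
    exact ⟨n + ε, m, by push_cast; ring⟩⟩

/-- The mode `J^0_n` of `J^0(z) = (1/√(2k)) i∂φ(z) = ∑_n J^0_n z^{-n-1}`. -/
def neutralCurrent (k : ℕ) (n : ℤ) : Module.End ℂ (ChiralSpace k) :=
  assemble k fun α =>
    fockInclusion k α ∘ₗ (((1 / √(2 * k) : ℝ) : ℂ) • oscillator α n)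

/-- For `ε = 1` and `ε = -1`, the modes `J^+_n` and `J^-_n` of
`J^±(z) = :e^{±i√(2k)φ(z)}: = ∑_n J^±_n z^{-n-k}`. -/
def chargedCurrent (k : ℕ) (ε : ℤ) (n : ℤ) : Module.End ℂ (ChiralSpace k) :=
  assemble k fun α =>
    fockInclusion k (shiftCharge k ε α) ∘ₗ vertexCoeff α (ε * √(2 * k)) (-n - k)

/-- The algebra of operators on `H` generated by all modes of `J^+`, `J^-` and `J^0`. -/
def currentAlgebra (k : ℕ) : Subalgebra ℂ (Module.End ℂ (ChiralSpace k)) :=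
  Algebra.adjoin ℂ (Set.range (chargedCurrent k 1) ∪ Set.range (chargedCurrent k (-1)) ∪
    Set.range (neutralCurrent k))

/-- The charge `m / √(2k) + n √(2k)`. -/
def sectorCharge (k : ℕ) (m n : ℤ) : charges k :=
  ⟨m / √(2 * k) + n * √(2 * k), n, m, add_comm _ _⟩

/-- The Fock module `F_α` as a subspace of `H`. -/
def fockSubspace (k : ℕ) (α : charges k) : Submodule ℂ (ChiralSpace k) :=
  LinearMap.range (fockInclusion k α)

/-- The subspace `𝓗_m = ∑_{n ∈ ℤ} F_{m/√(2k) + n√(2k)}` of `H`. -/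
def sector (k : ℕ) (m : ℤ) : Submodule ℂ (ChiralSpace k) :=
  ⨆ n : ℤ, fockSubspace k (sectorCharge k m n)

end TorusModel

end

/-!
Every `F_α` is an eigenspace of `J^0_0`, and distinct charges have distinct eigenvalues
`α / √(2k)`; hence the sum of the Fock modules is direct, and a submodule of `𝓗_m` that is
invariant under `J^0_0` is the sum of its intersections with them. The charges are the numbers
`N / √(2k)`, `N ∈ ℤ`, and the charges of `𝓗_m` are those with `N ≡ m` modulo `2k`, so division with
remainder gives the decomposition of `H`.

Let `W ≠ 0` be an invariant subspace of `𝓗_m`. It meets some `F_α` nontrivially. The annihilation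
modes `a_n` act as derivatives, so they bring a nonzero state of `F_α` down to `|α⟩`, from which the
creation modes generate `F_α`. The most singular term of `J^±(z)` sends `|α⟩` to `|α ± √(2k)⟩`, so
`W` contains the highest weight vector of every Fock module in `𝓗_m`.
-/

noncomputable section

namespace TorusModel

open MvPolynomial

section Lattice

variable {L ι : Type*} {κ : ι → Type*} [CompleteLattice L] [IsModularLattice L]
  [IsCompactlyGenerated L]

theorem iSupIndep_iSup_of_iSupIndep_sigma {t : ∀ i, κ i → L}
    (ht : iSupIndep fun p : Σ i, κ i => t p.1 p.2) : iSupIndep fun i => ⨆ j, t i j := by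
  intro i
  have hdisj : Disjoint {p : Σ i, κ i | p.1 = i} {p | p.1 ≠ i} :=
    Set.disjoint_left.mpr fun _ hp hp' => hp' hp
  refine (ht.disjoint_biSup_biSup hdisj).mono (iSup_le fun j => ?_)
    (iSup₂_le fun i' hi' => iSup_le fun j => ?_)
  · exact le_iSup₂_of_le (⟨i, j⟩ : Σ i, κ i) rfl le_rfl
  · exact le_iSup₂_of_le (⟨i', j⟩ : Σ i, κ i) hi' le_rfl

end Lattice

section InvariantSubmodules

theorem mem_invtSubmodule_of_mem_adjoin {R M : Type*} [CommSemiring R] [AddCommMonoid M]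
    [Module R M] {s : Set (Module.End R M)} {N : Submodule R M} (hs : ∀ f ∈ s, N ∈ f.invtSubmodule)
    {f : Module.End R M} (hf : f ∈ Algebra.adjoin R s) : N ∈ f.invtSubmodule := by
  induction hf using Algebra.adjoin_induction with
  | mem f hf => exact hs f hf
  | algebraMap c => exact fun _ hv => N.smul_mem c hv
  | add _ _ _ _ hf hg => exact fun _ hv => N.add_mem (hf hv) (hg hv)
  | mul _ _ _ _ hf hg => exact fun _ hv => hf (hg hv)

variable {K V ι : Type*} [Field K] [AddCommGroup V] [Module K V] {f : Module.End K V}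
  {W : Submodule K V}

theorem mem_of_sum_mem_of_mem_eigenspace (hW : W ∈ f.invtSubmodule) {μ : ι → K}
    (hμ : Function.Injective μ) {s : Finset ι} {v : ι → V}
    (hv : ∀ i ∈ s, v i ∈ f.eigenspace (μ i)) (hsum : ∑ i ∈ s, v i ∈ W) : ∀ i ∈ s, v i ∈ W := by
  have hle : W ≤ W.comap f := hW
  -- Modulo `W` the `v i` are eigenvectors of distinct eigenvalues with sum zero.
  have hv' : ∀ i ∈ s, W.mkQ (v i) ∈ Module.End.eigenspace (W.mapQ W f hle) (μ i) := fun i hi => by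
    rw [Module.End.mem_eigenspace_iff, Submodule.mkQ_apply, Submodule.mapQ_apply,
      Module.End.mem_eigenspace_iff.mp (hv i hi), Submodule.Quotient.mk_smul]
  have hsum' : ∑ i ∈ s, W.mkQ (v i) = 0 := by
    rwa [← map_sum, Submodule.mkQ_apply, Submodule.Quotient.mk_eq_zero]
  have hindep := (Module.End.eigenspaces_iSupIndep (W.mapQ W f hle)).comp hμ
  intro i hi
  exact (Submodule.Quotient.mk_eq_zero W).mp
    ((iSupIndep_iff_finsetSum_eq_zero_imp_eq_zero _).mp hindep s _ hv' hsum' i hi)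

theorem inf_iSup_eq_iSup_inf_of_le_eigenspace (hW : W ∈ f.invtSubmodule) {μ : ι → K}
    (hμ : Function.Injective μ) {U : ι → Submodule K V} (hU : ∀ i, U i ≤ f.eigenspace (μ i)) :
    W ⊓ ⨆ i, U i = ⨆ i, W ⊓ U i := by
  refine le_antisymm ?_ (iSup_inf_le_inf_iSup _ _)
  rintro _ ⟨hvW, hvU⟩
  obtain ⟨v, hv, rfl⟩ := (Submodule.mem_iSup_iff_exists_finsupp U _).mp hvU
  have hvW' := mem_of_sum_mem_of_mem_eigenspace hW hμ (fun i _ => hU i (hv i)) hvW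
  exact Submodule.sum_mem _ fun i hi => Submodule.mem_iSup_of_mem i ⟨hvW' i hi, hv i⟩

end InvariantSubmodules

section Polynomials

variable {σ R : Type*} [CommSemiring R]

theorem totalDegree_pderiv_le (i : σ) (p : MvPolynomial σ R) :
    (pderiv i p).totalDegree ≤ p.totalDegree - 1 := by
  refine Finset.sup_le fun e he => ?_
  rw [mem_support_iff, coeff_pderiv] at he
  have hdeg := le_totalDegree (mem_support_iff.mpr (left_ne_zero_of_mul he))
  rw [Finsupp.sum_add_index' (fun _ => rfl) (fun _ _ _ => rfl),
    Finsupp.sum_single_index rfl] at hdeg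
  omega

theorem exists_pderiv_ne_zero [NoZeroDivisors R] [CharZero R] {p : MvPolynomial σ R}
    (hp : p.totalDegree ≠ 0) : ∃ i, pderiv i p ≠ 0 := by
  obtain ⟨e, he, i, hi⟩ : ∃ e ∈ p.support, ∃ i, e i ≠ 0 := by
    rw [Ne, totalDegree_eq_zero_iff] at hp
    push Not at hp
    exact hp
  have he' : e - Finsupp.single i 1 + Finsupp.single i 1 = e :=
    tsub_add_cancel_of_le (Finsupp.single_le_iff.mpr (Nat.one_le_iff_ne_zero.mpr hi))
  refine ⟨i, ne_zero_iff.mpr ⟨e - Finsupp.single i 1, ?_⟩⟩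
  rw [coeff_pderiv, he']
  exact mul_ne_zero (mem_support_iff.mp he) (Nat.cast_add_one_ne_zero _)

theorem one_mem_of_pderiv_mem {K : Type*} [Semifield K] [CharZero K]
    {U : Submodule K (MvPolynomial σ K)} (hU : ∀ i, ∀ p ∈ U, pderiv i p ∈ U)
    {p : MvPolynomial σ K} (hp : p ∈ U) (hp0 : p ≠ 0) : 1 ∈ U := by
  induction h : p.totalDegree using Nat.strong_induction_on generalizing p with
  | h d ih =>
    rcases eq_or_ne d 0 with rfl | hd
    · obtain ⟨c, rfl⟩ : ∃ c, p = C c := ⟨_, totalDegree_eq_zero_iff_eq_C.mp h⟩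
      have hc : c ≠ 0 := fun hc => hp0 (by rw [hc, C_0])
      have hone : c⁻¹ • (C c : MvPolynomial σ K) = 1 := by
        rw [smul_eq_C_mul, ← C_mul, inv_mul_cancel₀ hc, C_1]
      exact hone ▸ U.smul_mem _ hp
    · obtain ⟨i, hi⟩ := exists_pderiv_ne_zero (h ▸ hd)
      have hlt := totalDegree_pderiv_le i p
      exact ih _ (by omega) (hU i p hp) hi rfl

theorem eq_top_of_one_mem_of_X_mul_mem {U : Submodule R (MvPolynomial σ R)} (h1 : 1 ∈ U)
    (hU : ∀ i, ∀ p ∈ U, X i * p ∈ U) : U = ⊤ := by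
  refine eq_top_iff.mpr fun p _ => ?_
  induction p using MvPolynomial.induction_on with
  | C a => simpa [smul_eq_C_mul] using U.smul_mem a h1
  | add p q hp hq => exact U.add_mem (hp trivial) (hq trivial)
  | mul_X p i hp => exact mul_comm p (X i) ▸ hU i p (hp trivial)

end Polynomials

section FockModule

theorem eq_top_of_mem_invtSubmodule_oscillator {α : ℝ} {U : Submodule ℂ (Fock α)}
    (hU : ∀ n, U ∈ (oscillator α n).invtSubmodule) (h0 : U ≠ ⊥) : U = ⊤ := by
  obtain ⟨p, hp, hp0⟩ := U.ne_bot_iff.mp h0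
  have hpderiv : ∀ j, ∀ q ∈ U, pderiv j q ∈ U := fun j q hq =>
    have h : ((j + 1 : ℕ) : ℂ) • pderiv j q ∈ U := hU (Int.ofNat (j + 1)) hq
    (U.smul_mem_iff (Nat.cast_ne_zero.mpr j.succ_ne_zero)).mp h
  exact eq_top_of_one_mem_of_X_mul_mem (one_mem_of_pderiv_mem hpderiv hp hp0)
    fun j _ hq => hU (Int.negSucc j) hq

theorem expCoeff_zero {A : Type*} [Ring A] [Algebra ℂ A] (t : ℕ → A) : expCoeff t 0 = 1 := by
  have hblocks (c : Composition 0) : c.blocks = [] :=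
    List.eq_nil_of_length_eq_zero (Nat.le_zero.mp c.length_le)
  simp [expCoeff, hblocks, Composition.length, composition_card]

theorem annihilationCoeff_monomial_of_level_lt (α β : ℝ) {N : ℕ} {e : ℕ →₀ ℕ}
    (he : level e < N) (c : ℂ) : annihilationCoeff α β N (monomial e c) = 0 := by
  simp only [annihilationCoeff, expCoeff, LinearMap.sum_apply, LinearMap.smul_apply]
  refine Finset.sum_eq_zero fun b _ => ?_
  rw [list_prod_annihilation_eq_zero α (fun n : ℕ => -(β : ℂ) / (n : ℂ)) b.blocks
    (fun _ hi => b.blocks_pos hi) e c (by rwa [b.blocks_sum]), smul_zero]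

theorem annihilationCoeff_one_of_ne_zero (α β : ℝ) {N : ℕ} (hN : N ≠ 0) :
    annihilationCoeff α β N 1 = 0 :=
  annihilationCoeff_monomial_of_level_lt α β
    (by simpa only [level, map_zero] using Nat.pos_of_ne_zero hN) 1

theorem vertexCoeff_add_natCast_one (α β : ℝ) (M : ℕ) :
    vertexCoeff α β (β * α + M) 1 = creationCoeff (α + β) β M 1 := by
  change ∑ᶠ p ∈ exponentPairs α β (β * α + M),
    creationCoeff (α + β) β p.1 (annihilationCoeff α β p.2 1) = _
  rw [finsum_mem_inter_support_eq _ _ {(M, 0)}]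
  · rw [finsum_mem_singleton, annihilationCoeff, expCoeff_zero, Module.End.one_apply]
  · ext ⟨M', N⟩
    refine and_congr_left fun hne => ?_
    obtain rfl : N = 0 := by
      by_contra hN
      exact hne (by simp only [annihilationCoeff_one_of_ne_zero α β hN, map_zero])
    simp [exponentPairs, add_comm]

theorem vertexCoeff_mul_one (α β : ℝ) : vertexCoeff α β (β * α) 1 = 1 := by
  have h := vertexCoeff_add_natCast_one α β 0
  rwa [Nat.cast_zero, add_zero, creationCoeff, expCoeff_zero, Module.End.one_apply] at h

end FockModule

section Charges

variable {k : ℕ}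

theorem coe_sectorCharge (hk : 0 < k) (m n : ℤ) :
    (sectorCharge k m n : ℝ) = ((m + 2 * k * n : ℤ) : ℝ) / √(2 * k) := by
  have hsq : √(2 * k : ℝ) * √(2 * k) = 2 * k := Real.mul_self_sqrt (by positivity)
  change (m : ℝ) / √(2 * k) + n * √(2 * k) = _
  field_simp
  push_cast
  linear_combination (n : ℝ) * hsq

theorem sectorCharge_eq_iff (hk : 0 < k) {m n m' n' : ℤ} :
    sectorCharge k m n = sectorCharge k m' n' ↔ m + 2 * k * n = m' + 2 * k * n' := by
  have hsqrt : √(2 * k : ℝ) ≠ 0 := by positivity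
  rw [← Subtype.coe_inj, coe_sectorCharge hk, coe_sectorCharge hk, div_left_inj' hsqrt,
    Int.cast_inj]

theorem sectorCharge_bijective (hk : 0 < k) :
    Function.Bijective fun p : Σ _ : Fin (2 * k), ℤ => sectorCharge k (p.1 : ℕ) p.2 := by
  have : NeZero (2 * k) := ⟨by omega⟩
  let e : (Σ _ : Fin (2 * k), ℤ) ≃ ℤ :=
    (Equiv.sigmaEquivProd _ _).trans ((Equiv.prodComm _ _).trans (Int.divModEquiv (2 * k)).symm)
  have he : (fun p : Σ _ : Fin (2 * k), ℤ => sectorCharge k (p.1 : ℕ) p.2) =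
      (fun N => sectorCharge k N 0) ∘ e := by
    funext p
    refine (sectorCharge_eq_iff hk).mpr ?_
    simp only [e, Equiv.trans_apply, Equiv.sigmaEquivProd_apply, Equiv.prodComm_apply,
      Prod.swap_prod_mk, Int.divModEquiv_symm_apply, Nat.cast_mul, Nat.cast_ofNat, mul_zero,
      add_zero]
    ring
  have hbij : Function.Bijective fun N => sectorCharge k N 0 := by
    refine ⟨fun N N' h => by simpa using (sectorCharge_eq_iff hk).mp h, ?_⟩
    rintro ⟨_, n, m, rfl⟩
    refine ⟨m + 2 * k * n, Eq.trans (b := sectorCharge k m n) ?_ (Subtype.ext (add_comm _ _))⟩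
    rw [sectorCharge_eq_iff hk, mul_zero, add_zero]
  exact he ▸ hbij.comp e.bijective

theorem sectorCharge_injective (hk : 0 < k) (m : ℤ) : Function.Injective (sectorCharge k m) :=
  fun n n' h => by
    rw [sectorCharge_eq_iff hk, add_right_inj] at h
    exact mul_left_cancel₀ (by positivity) h

theorem shiftCharge_sectorCharge (k : ℕ) (ε m n : ℤ) :
    shiftCharge k ε (sectorCharge k m n) = sectorCharge k m (n + ε) := by
  refine Subtype.ext ?_
  change (m : ℝ) / √(2 * k) + n * √(2 * k) + ε * √(2 * k) = m / √(2 * k) + (n + ε : ℤ) * √(2 * k)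
  push_cast
  ring

end Charges

section Currents

variable {k : ℕ}

theorem assemble_fockInclusion (k : ℕ) (f : ∀ α : charges k, Fock α →ₗ[ℂ] ChiralSpace k)
    (α : charges k) (p : Fock α) : assemble k f (fockInclusion k α p) = f α p :=
  DirectSum.toModule_lof ℂ _ _

theorem neutralCurrent_fockInclusion (k : ℕ) (n : ℤ) (α : charges k) (p : Fock α) :
    neutralCurrent k n (fockInclusion k α p) =
      ((1 / √(2 * k) : ℝ) : ℂ) • fockInclusion k α (oscillator α n p) := by
  rw [neutralCurrent, assemble_fockInclusion, LinearMap.comp_apply, LinearMap.smul_apply, map_smul]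

theorem chargedCurrent_fockInclusion (k : ℕ) (ε n : ℤ) (α : charges k) (p : Fock α) :
    chargedCurrent k ε n (fockInclusion k α p) =
      fockInclusion k (shiftCharge k ε α) (vertexCoeff α (ε * √(2 * k)) (-n - k) p) :=
  assemble_fockInclusion _ _ _ _

theorem fockSubspace_le_eigenspace (k : ℕ) (α : charges k) :
    fockSubspace k α ≤ (neutralCurrent k 0).eigenspace ((1 / √(2 * k) * α : ℝ) : ℂ) := by
  rintro _ ⟨p, rfl⟩
  rw [Module.End.mem_eigenspace_iff, neutralCurrent_fockInclusion, Complex.ofReal_mul, mul_smul]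
  exact congrArg _ (map_smul (fockInclusion k α) ((α : ℝ) : ℂ) p)

theorem neutralCurrent_eigenvalue_injective (hk : 0 < k) :
    Function.Injective fun α : charges k => ((1 / √(2 * k) * α : ℝ) : ℂ) :=
  Complex.ofReal_injective.comp
    ((mul_right_injective₀ (by positivity)).comp Subtype.coe_injective)

theorem iSupIndep_fockSubspace (hk : 0 < k) : iSupIndep (fockSubspace k) :=
  ((Module.End.eigenspaces_iSupIndep (neutralCurrent k 0)).comp
    (neutralCurrent_eigenvalue_injective hk)).mono (fockSubspace_le_eigenspace k)

theorem iSup_fockSubspace (k : ℕ) : ⨆ α, fockSubspace k α = ⊤ :=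
  DFinsupp.iSup_range_lsingle (R := ℂ) (M := fun α : charges k => Fock α)

theorem isInternal_sector (hk : 0 < k) :
    DirectSum.IsInternal fun m : Fin (2 * k) => sector k (m : ℕ) := by
  have hbij := sectorCharge_bijective hk
  have hindep : iSupIndep fun m : Fin (2 * k) => sector k (m : ℕ) :=
    iSupIndep_iSup_of_iSupIndep_sigma
      (t := fun (m : Fin (2 * k)) n => fockSubspace k (sectorCharge k (m : ℕ) n))
      ((iSupIndep_fockSubspace hk).comp hbij.injective)
  refine DirectSum.isInternal_submodule_of_iSupIndep_of_iSup_eq_top hindep ?_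
  calc ⨆ m : Fin (2 * k), sector k (m : ℕ)
      = ⨆ p : Σ _ : Fin (2 * k), ℤ, fockSubspace k (sectorCharge k (p.1 : ℕ) p.2) :=
        iSup_sigma' fun (m : Fin (2 * k)) n => fockSubspace k (sectorCharge k (m : ℕ) n)
    _ = ⨆ α, fockSubspace k α := hbij.surjective.iSup_comp (fockSubspace k)
    _ = ⊤ := iSup_fockSubspace k

end Currents

section Invariance

theorem sector_mem_invtSubmodule_neutralCurrent (k : ℕ) (m n : ℤ) :
    sector k m ∈ (neutralCurrent k n).invtSubmodule := by
  refine (Module.End.mem_invtSubmodule _).mpr (iSup_le fun j => ?_)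
  rintro _ ⟨p, rfl⟩
  rw [Submodule.mem_comap, neutralCurrent_fockInclusion]
  exact Submodule.smul_mem _ _ (Submodule.mem_iSup_of_mem j ⟨_, rfl⟩)

theorem sector_mem_invtSubmodule_chargedCurrent (k : ℕ) (m ε n : ℤ) :
    sector k m ∈ (chargedCurrent k ε n).invtSubmodule := by
  refine (Module.End.mem_invtSubmodule _).mpr (iSup_le fun j => ?_)
  rintro _ ⟨p, rfl⟩
  rw [Submodule.mem_comap, chargedCurrent_fockInclusion]
  refine Submodule.mem_iSup_of_mem (j + ε) ?_
  rw [← shiftCharge_sectorCharge]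
  exact ⟨_, rfl⟩

theorem sector_mem_invtSubmodule_of_mem_currentAlgebra {k : ℕ} (m : ℤ)
    {T : Module.End ℂ (ChiralSpace k)} (hT : T ∈ currentAlgebra k) :
    sector k m ∈ T.invtSubmodule := by
  refine mem_invtSubmodule_of_mem_adjoin ?_ hT
  rintro _ ((⟨n, rfl⟩ | ⟨n, rfl⟩) | ⟨n, rfl⟩)
  · exact sector_mem_invtSubmodule_chargedCurrent k m 1 n
  · exact sector_mem_invtSubmodule_chargedCurrent k m (-1) n
  · exact sector_mem_invtSubmodule_neutralCurrent k m n

/-- The space `𝓗_m` as a submodule over the algebra of the currents. -/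
def sectorSubmodule (k : ℕ) (m : ℤ) : Submodule (currentAlgebra k) (ChiralSpace k) where
  __ := sector k m
  smul_mem' T _ hv := sector_mem_invtSubmodule_of_mem_currentAlgebra m T.2 hv

end Invariance

section Irreducibility

variable {k : ℕ} {W : Submodule ℂ (ChiralSpace k)}

/-- The highest weight vector `|α⟩` of `F_α`, as a vector of `H`. -/
def vacuum (k : ℕ) (α : charges k) : ChiralSpace k :=
  fockInclusion k α 1

theorem vacuum_mem_fockSubspace (k : ℕ) (α : charges k) : vacuum k α ∈ fockSubspace k α :=
  ⟨1, rfl⟩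

theorem vacuum_ne_zero (k : ℕ) (α : charges k) : vacuum k α ≠ 0 := fun h =>
  one_ne_zero <| DirectSum.of_injective (β := fun α : charges k => Fock α) α
    (h.trans (map_zero _).symm)

/-- The mode index is minus the change `k + ε √(2k) α` of the conformal weight `α² / 2` under
`α ↦ α + ε √(2k)` (for `ε = ±1`), where `√(2k) α = m + 2kn`. -/
theorem chargedCurrent_vacuum (hk : 0 < k) (ε m n : ℤ) :
    chargedCurrent k ε (-(k + ε * (m + 2 * k * n))) (vacuum k (sectorCharge k m n)) =
      vacuum k (sectorCharge k m (n + ε)) := by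
  have hexp : -((-(k + ε * (m + 2 * k * n)) : ℤ) : ℝ) - k =
      ε * √(2 * k) * (sectorCharge k m n : ℝ) := by
    rw [coe_sectorCharge hk]
    field_simp
    push_cast
    ring
  rw [vacuum, chargedCurrent_fockInclusion, hexp, vertexCoeff_mul_one, ← shiftCharge_sectorCharge]
  rfl

theorem comap_fockInclusion_mem_invtSubmodule_oscillator (hk : 0 < k) {n : ℤ}
    (hW : W ∈ (neutralCurrent k n).invtSubmodule) (α : charges k) :
    W.comap (fockInclusion k α) ∈ (oscillator α n).invtSubmodule := by
  intro p hp
  have hmem : neutralCurrent k n (fockInclusion k α p) ∈ W := hW hp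
  rw [neutralCurrent_fockInclusion] at hmem
  have hsqrt : (1 / √(2 * k) : ℝ) ≠ 0 := by positivity
  exact (W.smul_mem_iff (Complex.ofReal_ne_zero.mpr hsqrt)).mp hmem

theorem fockSubspace_le_of_inf_ne_bot (hk : 0 < k)
    (hW : ∀ n, W ∈ (neutralCurrent k n).invtSubmodule) {α : charges k}
    (hα : W ⊓ fockSubspace k α ≠ ⊥) : fockSubspace k α ≤ W := by
  refine LinearMap.range_le_iff_comap.mpr (eq_top_of_mem_invtSubmodule_oscillator
    (fun n => comap_fockInclusion_mem_invtSubmodule_oscillator hk (hW n) α) fun hbot => hα ?_)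
  rw [inf_comm, fockSubspace, ← Submodule.map_comap_eq, hbot, Submodule.map_bot]

theorem fockSubspace_le_of_vacuum_mem (hk : 0 < k)
    (hW : ∀ n, W ∈ (neutralCurrent k n).invtSubmodule) {α : charges k}
    (hα : vacuum k α ∈ W) : fockSubspace k α ≤ W :=
  fockSubspace_le_of_inf_ne_bot hk hW
    ((Submodule.ne_bot_iff _).mpr ⟨_, ⟨hα, vacuum_mem_fockSubspace k α⟩, vacuum_ne_zero k α⟩)

theorem vacuum_sectorCharge_mem (hk : 0 < k)
    (hWplus : ∀ n, W ∈ (chargedCurrent k 1 n).invtSubmodule)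
    (hWminus : ∀ n, W ∈ (chargedCurrent k (-1) n).invtSubmodule) {m j : ℤ}
    (hj : vacuum k (sectorCharge k m j) ∈ W) (n : ℤ) : vacuum k (sectorCharge k m n) ∈ W := by
  induction n using Int.inductionOn' (b := j) with
  | zero => exact hj
  | succ n _ ih => exact chargedCurrent_vacuum hk 1 m n ▸ hWplus _ ih
  | pred n _ ih => exact chargedCurrent_vacuum hk (-1) m n ▸ hWminus _ ih

theorem exists_inf_fockSubspace_ne_bot (hk : 0 < k)
    (hW : W ∈ (neutralCurrent k 0).invtSubmodule) {m : ℤ} (hWm : W ≤ sector k m)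
    (hW0 : W ≠ ⊥) : ∃ n, W ⊓ fockSubspace k (sectorCharge k m n) ≠ ⊥ := by
  have hsup : W = ⨆ n, W ⊓ fockSubspace k (sectorCharge k m n) :=
    (inf_eq_left.mpr hWm).symm.trans <| inf_iSup_eq_iSup_inf_of_le_eigenspace hW
      ((neutralCurrent_eigenvalue_injective hk).comp (sectorCharge_injective hk m))
      fun n => fockSubspace_le_eigenspace k (sectorCharge k m n)
  by_contra! hbot
  exact hW0 (hsup.trans (iSup_eq_bot.mpr hbot))

theorem sector_le_of_ne_bot (hk : 0 < k) (hW : ∀ T ∈ currentAlgebra k, W ∈ T.invtSubmodule)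
    {m : ℤ} (hWm : W ≤ sector k m) (hW0 : W ≠ ⊥) : sector k m ≤ W := by
  have hneutral n : W ∈ (neutralCurrent k n).invtSubmodule :=
    hW _ (Algebra.subset_adjoin (Or.inr ⟨n, rfl⟩))
  have hplus n : W ∈ (chargedCurrent k 1 n).invtSubmodule :=
    hW _ (Algebra.subset_adjoin (Or.inl (Or.inl ⟨n, rfl⟩)))
  have hminus n : W ∈ (chargedCurrent k (-1) n).invtSubmodule :=
    hW _ (Algebra.subset_adjoin (Or.inl (Or.inr ⟨n, rfl⟩)))
  obtain ⟨j, hj⟩ := exists_inf_fockSubspace_ne_bot hk (hneutral 0) hWm hW0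
  have hvac := fockSubspace_le_of_inf_ne_bot hk hneutral hj (vacuum_mem_fockSubspace k _)
  exact iSup_le fun n => fockSubspace_le_of_vacuum_mem hk hneutral
    (vacuum_sectorCharge_mem hk hplus hminus hvac n)

theorem isSimpleModule_sectorSubmodule (hk : 0 < k) (m : ℤ) :
    IsSimpleModule (currentAlgebra k) (sectorSubmodule k m) := by
  refine isSimpleModule_iff_isAtom.mpr ⟨?_, fun W hW => ?_⟩
  · exact (Submodule.ne_bot_iff _).mpr ⟨vacuum k (sectorCharge k m 0),
      Submodule.mem_iSup_of_mem (0 : ℤ) (vacuum_mem_fockSubspace k _), vacuum_ne_zero k _⟩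
  · by_contra hW0
    have hinv : ∀ T ∈ currentAlgebra k, W.restrictScalars ℂ ∈ T.invtSubmodule :=
      fun T hT _ hv => W.smul_mem (⟨T, hT⟩ : currentAlgebra k) hv
    exact hW.not_ge (sector_le_of_ne_bot hk hinv hW.le
      fun h => hW0 ((Submodule.restrictScalars_eq_bot_iff ..).mp h))

end Irreducibility

end TorusModel

end

theorem mainTheorem1 (k : ℕ) (hk : 0 < k) :
    DirectSum.IsInternal (fun m : Fin (2 * k) => TorusModel.sector k (m : ℕ)) ∧
    ∀ m : Fin (2 * k),
      iSupIndep (fun n : ℤ =>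
        TorusModel.fockSubspace k (TorusModel.sectorCharge k (m : ℕ) n)) ∧
      ∃ N : Submodule (TorusModel.currentAlgebra k) (TorusModel.ChiralSpace k),
        N.restrictScalars ℂ = TorusModel.sector k (m : ℕ) ∧
        IsSimpleModule (TorusModel.currentAlgebra k) N := by
  refine ⟨TorusModel.isInternal_sector hk, fun m => ⟨?_, ?_⟩⟩
  · exact (TorusModel.iSupIndep_fockSubspace hk).comp (TorusModel.sectorCharge_injective hk _)
  · exact ⟨TorusModel.sectorSubmodule k (m : ℕ), rfl,
      TorusModel.isSimpleModule_sectorSubmodule hk _⟩
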